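/- Let $G=(V,E)$ be a connected, simple, undirected, locally finite (possibly infinite) graph, and let $d(\cdot,\cdot)$ be its graph distance and $d_x$ the degree of a vertex $x$. For $p\in[0,1]$ let $\mu_x^p$ be the probability measure on $V$ with $\mu_x^p(x)=p$, $\mu_x^p(y)=\frac{1-p}{d_x}$ if $xy\in E$, and $\mu_x^p(y)=0$ otherwise. Let $$W(\mu_1,\mu_2)=\inf_{\pi}\sum_{x,y\in V}d(x,y)\,\pi(x,y)$$ be the Wasserstein distance, the infimum being over all maps $\pi:V\times V\to[0,1]$ with $\sum_{y}\pi(x,y)=\mu_1(x)$ for all $x$ and $\sum_{x}\pi(x,y)=\mu_2(y)$ for all $y$. The Lin-Lu-Yau curvature of two adjacent vertices $x,y$ is $$\kappa_{LLY}(x,y)=\lim_{p\to1^-}\frac{1}{1-p}\left(1-\frac{W(\mu_x^p,\mu_y^p)}{d(x,y)}\right).$$ Let $\delta(G)=\min_{x\in V}d_x$ be the minimum vertex degree, and let the edge-connectivity $k'(G)$ be the minimum number of edges whose removal disconnects $G$ (with $k'(G)=0$ if $G$ has a single vertex). If $\kappa_{LLY}(x,y)>0$ for every pair of adjacent vertices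 $x,y$ of $G$, then $$k'(G)=\delta(G).$$ -/

import Mathlib

open Filter Topology
open scoped ENNReal

noncomputable section

namespace LLY

variable {V : Type*}

/-- The probability measure `μ_x^p` around a vertex `x` with idleness `p`, as a function on the
vertices: mass `p` at `x` and mass `(1 - p) / d_x` at each neighbour of `x`. -/
def ballMeasure (G : SimpleGraph V) [G.LocallyFinite] (p : ℝ) (x : V) : V → ℝ :=
  open Classical in
  fun y => if y = x then p else if G.Adj x y then (1 - p) / (G.degree x : ℝ) else 0

/-- `π` is a transport plan from `μ₁` to `μ₂`: a map `V × V → [0,1]` with marginals `μ₁`, `μ₂`. -/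
structure IsTransportPlan (μ₁ μ₂ : V → ℝ) (π : V → V → ℝ) : Prop where
  nonneg : ∀ x y, 0 ≤ π x y
  le_one : ∀ x y, π x y ≤ 1
  fst_marginal : ∀ x, HasSum (fun y => π x y) (μ₁ x)
  snd_marginal : ∀ y, HasSum (fun x => π x y) (μ₂ y)

/-- The cost `∑_{x,y} d(x,y) π(x,y) ∈ [0,∞]` of a transport plan on a connected graph. -/
def transportCost (G : SimpleGraph V) (π : V → V → ℝ) : ℝ≥0∞ :=
  ∑' x, ∑' y, ENNReal.ofReal ((G.dist x y : ℝ) * π x y)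

/-- The Wasserstein distance `W(μ₁, μ₂) ∈ [0,∞]` on a connected graph. -/
def wasserstein (G : SimpleGraph V) (μ₁ μ₂ : V → ℝ) : ℝ≥0∞ :=
  ⨅ (π : V → V → ℝ) (_ : IsTransportPlan μ₁ μ₂ π), transportCost G π

/-- The `p`-Ollivier curvature `κ_p(x,y) = 1 - W(μ_x^p, μ_y^p) / d(x,y)`. (The measures have finite
support, so for `p ∈ [0,1]` and non-isolated vertices of a connected graph `W` is finite.) -/
def ollivierCurvature (G : SimpleGraph V) [G.LocallyFinite] (p : ℝ) (x y : V) : ℝ :=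
  1 - (wasserstein G (ballMeasure G p x) (ballMeasure G p y)).toReal / (G.dist x y : ℝ)

/-- The Lin–Lu–Yau curvature `κ_LLY(x,y) = lim_{p → 1} κ_p(x,y) / (1 - p)`, with `p < 1`. -/
def curvature (G : SimpleGraph V) [G.LocallyFinite] (x y : V) : ℝ :=
  limUnder (𝓝[<] (1 : ℝ)) fun p => ollivierCurvature G p x y / (1 - p)

/-- `G` has positive Lin–Lu–Yau curvature: `κ_LLY(x,y) > 0` for all adjacent vertices `x, y`. -/
def HasPositiveCurvature (G : SimpleGraph V) [G.LocallyFinite] : Prop :=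
  ∀ x y, G.Adj x y → 0 < curvature G x y

/-- The minimum vertex degree of a (non-empty, possibly infinite) locally finite graph. -/
def minDegree (G : SimpleGraph V) [G.LocallyFinite] : ℕ :=
  ⨅ v, G.degree v

/-- The edge-connectivity: the minimum number of edges whose removal disconnects the graph, and
`0` for a graph with a single vertex. -/
def edgeConnectivity (G : SimpleGraph V) : ℕ∞ :=
  open Classical in
  if Nontrivial V then
    sInf {n : ℕ∞ | ∃ S : Set (Sym2 V), S ⊆ G.edgeSet ∧ S.encard = n ∧
      ¬ (G.deleteEdges S).Connected}
  else 0

end LLY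

end

/-!
By convexity of the Wasserstein distance, `κ_p(x,y) / (1 - p)` is monotone in `p`, and Kantorovich
duality bounds it by a difference of Laplacians of any `1`-Lipschitz function that increases by
`d(x,y)` from `x` to `y`. So the limit defining the curvature exists and obeys the same bound.

Apply this to the signed distance to a minimum edge cut with `k < δ(G)` edges: for every edge of the
cut, one of the two ends is exposed, i.e. has more neighbours across the cut than in the interior of
its own side. Counting cut edges and using that all degrees exceed `k`, each side has at most one
exposed vertex. A side has exactly one: if it had none, all cut edges would meet the exposed vertex
of the other side, and moving that vertex across would give a smaller cut. Hence all cut edges meet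
one of the exposed vertices `x`, `y`. The curvature of a cut edge at `x` other than `xy`, and of one
at `y`, then forces `x` and `y` to have more cut edges than `k` allows.
-/

namespace LLY

open scoped NNReal

variable {V : Type*} {G : SimpleGraph V}

section Transport

variable {μ₁ μ₂ f : V → ℝ} {π : V → V → ℝ} {s t : Finset V}

theorem IsTransportPlan.eq_zero_of_left (h : IsTransportPlan μ₁ μ₂ π) {x : V} (hx : μ₁ x = 0)
    (y : V) : π x y = 0 :=
  congrFun ((hasSum_zero_iff_of_nonneg (h.nonneg x)).1 (hx ▸ h.fst_marginal x)) y

theorem IsTransportPlan.eq_zero_of_right (h : IsTransportPlan μ₁ μ₂ π) {y : V} (hy : μ₂ y = 0)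
    (x : V) : π x y = 0 :=
  congrFun ((hasSum_zero_iff_of_nonneg fun x => h.nonneg x y).1 (hy ▸ h.snd_marginal y)) x

theorem IsTransportPlan.sum_snd (h : IsTransportPlan μ₁ μ₂ π) (ht : μ₂.support ⊆ t) (x : V) :
    ∑ y ∈ t, π x y = μ₁ x :=
  (hasSum_sum_of_ne_finset_zero fun _ hy => h.eq_zero_of_right
    (Function.notMem_support.1 fun hy' => hy (ht hy')) x).unique (h.fst_marginal x)

theorem IsTransportPlan.sum_fst (h : IsTransportPlan μ₁ μ₂ π) (hs : μ₁.support ⊆ s) (y : V) :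
    ∑ x ∈ s, π x y = μ₂ y :=
  (hasSum_sum_of_ne_finset_zero fun _ hx => h.eq_zero_of_left
    (Function.notMem_support.1 fun hx' => hx (hs hx')) y).unique (h.snd_marginal y)

theorem IsTransportPlan.prod (h₁ : 0 ≤ μ₁) (h₂ : 0 ≤ μ₂) (hμ₁ : HasSum μ₁ 1)
    (hμ₂ : HasSum μ₂ 1) : IsTransportPlan μ₁ μ₂ fun x y => μ₁ x * μ₂ y where
  nonneg x y := mul_nonneg (h₁ x) (h₂ y)
  le_one x y :=
    mul_le_one₀ (le_hasSum hμ₁ x fun z _ => h₁ z) (h₂ y) (le_hasSum hμ₂ y fun z _ => h₂ z)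
  fst_marginal x := by simpa using hμ₂.mul_left (μ₁ x)
  snd_marginal y := by simpa using hμ₁.mul_right (μ₂ y)

theorem IsTransportPlan.convexComb {ν₁ ν₂ : V → ℝ} {ρ : V → V → ℝ}
    (hπ : IsTransportPlan μ₁ μ₂ π) (hρ : IsTransportPlan ν₁ ν₂ ρ) {a b : ℝ≥0} (hab : a + b = 1) :
    IsTransportPlan (a • μ₁ + b • ν₁) (a • μ₂ + b • ν₂) (a • π + b • ρ) where
  nonneg x y := add_nonneg (mul_nonneg a.2 (hπ.nonneg x y)) (mul_nonneg b.2 (hρ.nonneg x y))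
  le_one x y := convex_Iic (𝕜 := ℝ≥0) (1 : ℝ) (hπ.le_one x y) (hρ.le_one x y) a.2 b.2 hab
  fst_marginal x := ((hπ.fst_marginal x).const_smul a).add ((hρ.fst_marginal x).const_smul b)
  snd_marginal y := ((hπ.snd_marginal y).const_smul a).add ((hρ.snd_marginal y).const_smul b)

theorem transportCost_smul_add_smul {ρ : V → V → ℝ} (hπ : 0 ≤ π) (hρ : 0 ≤ ρ) (a b : ℝ≥0) :
    transportCost G (a • π + b • ρ) = a • transportCost G π + b • transportCost G ρ := by
  have hterm (x y : V) : ENNReal.ofReal (G.dist x y * (a • π + b • ρ) x y) =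
      a * ENNReal.ofReal (G.dist x y * π x y) + b * ENNReal.ofReal (G.dist x y * ρ x y) := by
    have hπxy := mul_nonneg (Nat.cast_nonneg (α := ℝ) (G.dist x y)) (hπ x y)
    have hρxy := mul_nonneg (Nat.cast_nonneg (α := ℝ) (G.dist x y)) (hρ x y)
    rw [← ENNReal.ofReal_coe_nnreal, ← ENNReal.ofReal_coe_nnreal, ← ENNReal.ofReal_mul a.coe_nonneg,
      ← ENNReal.ofReal_mul b.coe_nonneg,
      ← ENNReal.ofReal_add (mul_nonneg a.coe_nonneg hπxy) (mul_nonneg b.coe_nonneg hρxy)]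
    simp only [Pi.add_apply, Pi.smul_apply, NNReal.smul_def, smul_eq_mul]
    ring_nf
  simp only [transportCost, hterm, ENNReal.tsum_add, ENNReal.tsum_mul_left, ENNReal.smul_def,
    smul_eq_mul]

theorem convexOn_wasserstein (G : SimpleGraph V) :
    ConvexOn ℝ≥0 Set.univ fun μ : (V → ℝ) × (V → ℝ) => wasserstein G μ.1 μ.2 := by
  refine convexOn_iff_forall_pos.2 ⟨convex_univ, fun μ _ ν _ a b ha hb hab => ?_⟩
  simp only [wasserstein, ENNReal.smul_def, smul_eq_mul,
    ENNReal.mul_iInf_of_ne (ENNReal.coe_ne_zero.2 ha.ne') ENNReal.coe_ne_top,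
    ENNReal.mul_iInf_of_ne (ENNReal.coe_ne_zero.2 hb.ne') ENNReal.coe_ne_top]
  refine ENNReal.le_iInf₂_add_iInf₂ fun π hπ ρ hρ => ?_
  exact (iInf₂_le _ (hπ.convexComb hρ hab)).trans_eq
    (transportCost_smul_add_smul hπ.nonneg hρ.nonneg a b)

theorem IsTransportPlan.transportCost_eq_sum (h : IsTransportPlan μ₁ μ₂ π)
    (hs : μ₁.support ⊆ s) (ht : μ₂.support ⊆ t) :
    transportCost G π = ENNReal.ofReal (∑ x ∈ s, ∑ y ∈ t, G.dist x y * π x y) := by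
  have hnonneg (x y : V) : 0 ≤ G.dist x y * π x y := mul_nonneg (Nat.cast_nonneg _) (h.nonneg x y)
  rw [transportCost, ENNReal.ofReal_sum_of_nonneg
    fun x _ => Finset.sum_nonneg fun y _ => hnonneg x y, tsum_eq_sum (s := s)]
  · refine Finset.sum_congr rfl fun x _ => ?_
    rw [ENNReal.ofReal_sum_of_nonneg fun y _ => hnonneg x y, tsum_eq_sum (s := t)]
    intro y hy
    simp [h.eq_zero_of_right (Function.notMem_support.1 fun hy' => hy (ht hy'))]
  · intro x hx
    simp [h.eq_zero_of_left (Function.notMem_support.1 fun hx' => hx (hs hx'))]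

theorem wasserstein_ne_top (h₁ : 0 ≤ μ₁) (h₂ : 0 ≤ μ₂) (hμ₁ : HasSum μ₁ 1) (hμ₂ : HasSum μ₂ 1)
    (hs : μ₁.support ⊆ s) (ht : μ₂.support ⊆ t) : wasserstein G μ₁ μ₂ ≠ ⊤ := by
  have hplan := IsTransportPlan.prod h₁ h₂ hμ₁ hμ₂
  refine ne_top_of_le_ne_top ?_ (iInf₂_le _ hplan)
  rw [hplan.transportCost_eq_sum hs ht]
  exact ENNReal.ofReal_ne_top

theorem ofReal_sum_sub_sum_le_wasserstein (hs : μ₁.support ⊆ s) (ht : μ₂.support ⊆ t)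
    (hf : ∀ x y, f y - f x ≤ G.dist x y) :
    ENNReal.ofReal (∑ y ∈ t, f y * μ₂ y - ∑ x ∈ s, f x * μ₁ x) ≤ wasserstein G μ₁ μ₂ := by
  refine le_iInf₂ fun π hπ => ?_
  rw [hπ.transportCost_eq_sum hs ht]
  refine ENNReal.ofReal_le_ofReal ?_
  have hfst : ∑ x ∈ s, f x * μ₁ x = ∑ x ∈ s, ∑ y ∈ t, f x * π x y :=
    Finset.sum_congr rfl fun x _ => by rw [← Finset.mul_sum, hπ.sum_snd ht]
  have hsnd : ∑ y ∈ t, f y * μ₂ y = ∑ x ∈ s, ∑ y ∈ t, f y * π x y := by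
    rw [Finset.sum_comm]
    exact Finset.sum_congr rfl fun y _ => by rw [← Finset.mul_sum, hπ.sum_fst hs]
  simp only [hfst, hsnd, ← Finset.sum_sub_distrib, ← sub_mul]
  exact Finset.sum_le_sum fun x _ => Finset.sum_le_sum fun y _ =>
    mul_le_mul_of_nonneg_right (hf x y) (hπ.nonneg x y)

theorem wasserstein_single [DecidableEq V] (G : SimpleGraph V) (x y : V) :
    wasserstein G (Pi.single x 1) (Pi.single y 1) = ENNReal.ofReal (G.dist x y) := by
  have hsupp (v : V) : (Pi.single v 1 : V → ℝ).support ⊆ ({v} : Finset V) := by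
    simp
  have hnonneg (v : V) : (0 : V → ℝ) ≤ Pi.single v 1 := Pi.single_nonneg.2 zero_le_one
  have hcost {π : V → V → ℝ} (hπ : IsTransportPlan (Pi.single x 1) (Pi.single y 1) π) :
      transportCost G π = ENNReal.ofReal (G.dist x y) := by
    have hπxy : π x y = 1 := by simpa using hπ.sum_snd (hsupp y) x
    simpa [hπxy] using hπ.transportCost_eq_sum (hsupp x) (hsupp y)
  have hplan := IsTransportPlan.prod (hnonneg x) (hnonneg y) (hasSum_pi_single x 1)
    (hasSum_pi_single y 1)
  exact le_antisymm (iInf₂_le_of_le _ hplan (hcost hplan).le) (le_iInf₂ fun π hπ => (hcost hπ).ge)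

end Transport

section Curvature

variable {f : V → ℝ}

theorem sub_le_dist_of_reachable (hf : ∀ u v, G.Adj u v → f v - f u ≤ 1) {u v : V}
    (huv : G.Reachable u v) : f v - f u ≤ G.dist u v := by
  obtain ⟨w, hw⟩ := huv.exists_walk_length_eq_dist
  rw [← hw]
  clear hw
  induction w with
  | nil => simp
  | cons h w ih =>
    rw [SimpleGraph.Walk.length_cons]
    push_cast
    linarith [hf _ _ h, ih w.reachable]

variable [G.LocallyFinite] {p : ℝ} {x y : V}

/-- The normalized graph Laplacian `Δf(x)`, the mean of `f(v) - f(x)` over the neighbours `v` of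
`x`; its differences along edges bound the curvature from above. It is `0` at isolated vertices. -/
noncomputable def laplacian (G : SimpleGraph V) [G.LocallyFinite] (f : V → ℝ) (x : V) : ℝ :=
  (∑ v ∈ G.neighborFinset x, (f v - f x)) / G.degree x

theorem support_ballMeasure_subset [DecidableEq V] (p : ℝ) (x : V) :
    (ballMeasure G p x).support ⊆ (insert x (G.neighborFinset x) : Finset V) := by
  intro v hv
  contrapose! hv
  have hv : v ≠ x ∧ ¬ G.Adj x v := by simpa using hv
  simp [ballMeasure, hv]

theorem sum_mul_ballMeasure [DecidableEq V] (hx : 0 < G.degree x) (f : V → ℝ) (p : ℝ) :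
    ∑ v ∈ insert x (G.neighborFinset x), f v * ballMeasure G p x v =
      f x + (1 - p) * laplacian G f x := by
  have hneighbor : ∀ v ∈ G.neighborFinset x,
      f v * ballMeasure G p x v = (1 - p) / G.degree x * f v := by
    intro v hv
    rw [SimpleGraph.mem_neighborFinset] at hv
    simp [ballMeasure, hv.ne', hv, mul_comm]
  have hdeg : (G.degree x : ℝ) ≠ 0 := by positivity
  rw [Finset.sum_insert (by simp), Finset.sum_congr rfl hneighbor, ← Finset.mul_sum, laplacian,
    Finset.sum_sub_distrib, Finset.sum_const, G.card_neighborFinset_eq_degree, nsmul_eq_mul]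
  simp only [ballMeasure, if_true]
  field_simp
  ring

theorem hasSum_ballMeasure (hx : 0 < G.degree x) (p : ℝ) : HasSum (ballMeasure G p x) 1 := by
  classical
  have hsum := sum_mul_ballMeasure hx 1 p
  simp only [laplacian, Pi.one_apply, one_mul, sub_self, Finset.sum_const_zero, zero_div, mul_zero,
    add_zero] at hsum
  exact hsum ▸ hasSum_sum_of_ne_finset_zero fun v hv =>
    Function.notMem_support.1 fun hv' => hv (support_ballMeasure_subset p x hv')

theorem ballMeasure_nonneg (hp : p ∈ Set.Icc (0 : ℝ) 1) (x : V) : 0 ≤ ballMeasure G p x := by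
  intro v
  have := hp.1
  have := sub_nonneg.2 hp.2
  unfold ballMeasure
  split_ifs <;> simp only [Pi.zero_apply] <;> positivity

theorem ballMeasure_one [DecidableEq V] (x : V) : ballMeasure G 1 x = Pi.single x 1 := by
  funext v
  simp [ballMeasure, Pi.single_apply]

theorem ballMeasure_convexComb (p q : ℝ) {a b : ℝ≥0} (hab : a + b = 1) (x : V) :
    ballMeasure G (a * p + b * q) x = a • ballMeasure G p x + b • ballMeasure G q x := by
  have hab : (a : ℝ) + b = 1 := mod_cast hab
  funext v
  simp only [ballMeasure, Pi.add_apply, Pi.smul_apply, NNReal.smul_def, smul_eq_mul]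
  split_ifs
  · rfl
  · linear_combination -(hab / G.degree x)
  · ring

theorem wasserstein_ballMeasure_ne_top (hx : 0 < G.degree x) (hy : 0 < G.degree y)
    (hp : p ∈ Set.Icc (0 : ℝ) 1) :
    wasserstein G (ballMeasure G p x) (ballMeasure G p y) ≠ ⊤ := by
  classical
  exact wasserstein_ne_top (ballMeasure_nonneg hp x) (ballMeasure_nonneg hp y)
    (hasSum_ballMeasure hx p) (hasSum_ballMeasure hy p)
    (support_ballMeasure_subset p x) (support_ballMeasure_subset p y)

theorem convexOn_toReal_wasserstein_ballMeasure (hx : 0 < G.degree x) (hy : 0 < G.degree y) :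
    ConvexOn ℝ (Set.Icc 0 1)
      fun p => (wasserstein G (ballMeasure G p x) (ballMeasure G p y)).toReal := by
  refine ⟨convex_Icc 0 1, fun p hp q hq a b ha hb hab => ?_⟩
  lift a to ℝ≥0 using ha
  lift b to ℝ≥0 using hb
  have hab : a + b = 1 := mod_cast hab
  have hWp : a * wasserstein G (ballMeasure G p x) (ballMeasure G p y) ≠ ⊤ :=
    ENNReal.mul_ne_top ENNReal.coe_ne_top (wasserstein_ballMeasure_ne_top hx hy hp)
  have hWq : b * wasserstein G (ballMeasure G q x) (ballMeasure G q y) ≠ ⊤ :=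
    ENNReal.mul_ne_top ENNReal.coe_ne_top (wasserstein_ballMeasure_ne_top hx hy hq)
  have hconv := (convexOn_wasserstein G).2 (Set.mem_univ (ballMeasure G p x, ballMeasure G p y))
    (Set.mem_univ (ballMeasure G q x, ballMeasure G q y)) a.2 b.2 hab
  simpa [ballMeasure_convexComb p q hab, ENNReal.smul_def, ENNReal.toReal_add hWp hWq] using
    ENNReal.toReal_mono (ENNReal.add_ne_top.2 ⟨hWp, hWq⟩) hconv

theorem ollivierCurvature_div_eq_slope_div (hxy : G.dist x y ≠ 0) (p : ℝ) :
    ollivierCurvature G p x y / (1 - p) =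
      slope (fun q => (wasserstein G (ballMeasure G q x) (ballMeasure G q y)).toReal) 1 p /
        G.dist x y := by
  classical
  have hdist : (G.dist x y : ℝ) ≠ 0 := Nat.cast_ne_zero.2 hxy
  rw [slope_def_field, ballMeasure_one, ballMeasure_one, wasserstein_single,
    ENNReal.toReal_ofReal (Nat.cast_nonneg _), ← neg_sub 1 p, div_neg, ← neg_div, neg_sub,
    div_right_comm, ollivierCurvature, sub_div (G.dist x y : ℝ),
    div_self hdist]

theorem degree_pos_of_dist_ne_zero (hxy : G.dist x y ≠ 0) :
    0 < G.degree x ∧ 0 < G.degree y := by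
  obtain ⟨hne, hreach⟩ := SimpleGraph.dist_ne_zero_iff_ne_and_reachable.1 hxy
  exact ⟨hreach.degree_pos_left hne, hreach.degree_pos_right hne⟩

theorem monotoneOn_ollivierCurvature_div (hxy : G.dist x y ≠ 0) :
    MonotoneOn (fun p => ollivierCurvature G p x y / (1 - p)) (Set.Ioo 0 1) := by
  obtain ⟨hx, hy⟩ := degree_pos_of_dist_ne_zero hxy
  intro p hp q hq hpq
  simp only [ollivierCurvature_div_eq_slope_div hxy]
  exact div_le_div_of_nonneg_right ((convexOn_toReal_wasserstein_ballMeasure hx hy).slope_mono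
    (Set.right_mem_Icc.2 zero_le_one) ⟨Set.Ioo_subset_Icc_self hp, hp.2.ne⟩
    ⟨Set.Ioo_subset_Icc_self hq, hq.2.ne⟩ hpq) (Nat.cast_nonneg _)

theorem ollivierCurvature_div_le (hxy : G.dist x y ≠ 0) (hf : ∀ u v, f v - f u ≤ G.dist u v)
    (hfxy : f y - f x = G.dist x y) (hp : p ∈ Set.Ico (0 : ℝ) 1) :
    ollivierCurvature G p x y / (1 - p) ≤ (laplacian G f x - laplacian G f y) / G.dist x y := by
  classical
  obtain ⟨hx, hy⟩ := degree_pos_of_dist_ne_zero hxy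
  have hdist : 0 < (G.dist x y : ℝ) := Nat.cast_pos.2 (Nat.pos_of_ne_zero hxy)
  have hW := (ENNReal.ofReal_le_iff_le_toReal (wasserstein_ballMeasure_ne_top hx hy
    (Set.Ico_subset_Icc_self hp))).1 (ofReal_sum_sub_sum_le_wasserstein
      (support_ballMeasure_subset p x) (support_ballMeasure_subset p y) hf)
  rw [sum_mul_ballMeasure hx, sum_mul_ballMeasure hy] at hW
  rw [div_le_iff₀ (sub_pos.2 hp.2), ollivierCurvature, one_sub_div hdist.ne',
    div_mul_eq_mul_div]
  gcongr
  linarith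

theorem curvature_le (hxy : G.dist x y ≠ 0) (hf : ∀ u v, f v - f u ≤ G.dist u v)
    (hfxy : f y - f x = G.dist x y) :
    curvature G x y ≤ (laplacian G f x - laplacian G f y) / G.dist x y := by
  have hbound : ∀ p ∈ Set.Ioo (0 : ℝ) 1, ollivierCurvature G p x y / (1 - p) ≤
      (laplacian G f x - laplacian G f y) / G.dist x y :=
    fun p hp => ollivierCurvature_div_le hxy hf hfxy (Set.Ioo_subset_Ico_self hp)
  have hlim := (monotoneOn_ollivierCurvature_div hxy).tendsto_nhdsWithin_Ioo_left
    (Set.nonempty_Ioo.2 zero_lt_one) ⟨_, Set.forall_mem_image.2 hbound⟩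
  rw [curvature, hlim.limUnder_eq]
  exact le_of_tendsto hlim (Filter.mem_of_superset (Ioo_mem_nhdsLT zero_lt_one) hbound)

end Curvature

section EdgesBetween

variable {s t : Set V} {x : V}

/-- The number of neighbours of `x` in `s`; as it is defined by `Set.ncard`, it is only meaningful
if that number is finite. -/
noncomputable def degreeIn (G : SimpleGraph V) (s : Set V) (x : V) : ℕ :=
  (G.neighborSet x ∩ s).ncard

/-- The edges between `s` and `t`, oriented from `s` to `t`, so that each is counted once if `s`
and `t` are disjoint. -/
def edgesBetween (G : SimpleGraph V) (s t : Set V) : Set (V × V) :=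
  {e | e.1 ∈ s ∧ e.2 ∈ t ∧ G.Adj e.1 e.2}

theorem degreeIn_pos_iff [G.LocallyFinite] : 0 < degreeIn G s x ↔ ∃ y ∈ s, G.Adj x y := by
  rw [degreeIn, Set.ncard_pos (Set.toFinite _)]
  exact exists_congr fun y => and_comm

theorem degreeIn_lt_ncard (hs : s.Finite) (hx : x ∈ s) : degreeIn G s x < s.ncard :=
  Set.ncard_lt_ncard ⟨Set.inter_subset_right, fun h => G.loopless.irrefl x (h hx).1⟩ hs

theorem degreeIn_univ [G.LocallyFinite] (x : V) : degreeIn G Set.univ x = G.degree x := by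
  rw [degreeIn, Set.inter_univ, Set.ncard_eq_toFinset_card', Set.toFinset_card,
    G.card_neighborSet_eq_degree]

theorem degreeIn_sdiff_singleton_self (s : Set V) (x : V) :
    degreeIn G (s \ {x}) x = degreeIn G s x := by
  rw [degreeIn, ← Set.inter_sdiff_assoc,
    Set.sdiff_singleton_eq_self fun h => G.loopless.irrefl x h.1, degreeIn]

theorem degreeIn_union [G.LocallyFinite] (h : Disjoint s t) (x : V) :
    degreeIn G (s ∪ t) x = degreeIn G s x + degreeIn G t x := by
  rw [degreeIn, Set.inter_union_distrib_left, Set.ncard_union_eq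
    (h.mono Set.inter_subset_right Set.inter_subset_right), degreeIn, degreeIn]

theorem sum_indicator_one_neighborFinset [G.LocallyFinite] (s : Set V) (x : V) :
    ∑ v ∈ G.neighborFinset x, s.indicator (1 : V → ℝ) v = degreeIn G s x := by
  classical
  simp only [Set.indicator_apply, Pi.one_apply, Finset.sum_boole, degreeIn]
  rw [← Set.ncard_coe_finset, Finset.coe_filter]
  simp only [SimpleGraph.mem_neighborFinset]
  rfl

theorem encard_edgesBetween_comm (s t : Set V) :
    (edgesBetween G s t).encard = (edgesBetween G t s).encard := by
  have hswap : Prod.swap '' edgesBetween G t s = edgesBetween G s t := by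
    rw [Set.image_swap_eq_preimage_swap]
    ext e
    simp only [edgesBetween, Set.mem_preimage, Set.mem_ofPred_eq, Prod.fst_swap, Prod.snd_swap,
      G.adj_comm e.2, and_left_comm]
  rw [← hswap, Prod.swap_injective.encard_image]

theorem encard_edgesBetween_union_left {s' : Set V} (h : Disjoint s s') (t : Set V) :
    (edgesBetween G (s ∪ s') t).encard =
      (edgesBetween G s t).encard + (edgesBetween G s' t).encard := by
  rw [← Set.encard_union_eq (Set.disjoint_left.2 fun e he he' => h.notMem_of_mem_left he.1 he'.1)]
  congr 1
  ext e
  exact or_and_right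

theorem encard_edgesBetween_union_right {t' : Set V} (h : Disjoint t t') (s : Set V) :
    (edgesBetween G s (t ∪ t')).encard =
      (edgesBetween G s t).encard + (edgesBetween G s t').encard := by
  simp only [encard_edgesBetween_comm s, encard_edgesBetween_union_left h]

theorem encard_edgesBetween_singleton_left [G.LocallyFinite] (x : V) (t : Set V) :
    (edgesBetween G {x} t).encard = degreeIn G t x := by
  have himage : edgesBetween G {x} t = Prod.mk x '' (G.neighborSet x ∩ t) := by
    ext ⟨u, v⟩
    simp only [edgesBetween, Set.mem_ofPred_eq, Set.mem_singleton_iff, Set.mem_image,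
      Set.mem_inter_iff, SimpleGraph.mem_neighborSet, Prod.mk.injEq]
    grind
  rw [himage, (Prod.mk_right_injective x).encard_image, degreeIn,
    (Set.toFinite (G.neighborSet x ∩ t)).cast_ncard_eq]

theorem encard_edgesBetween_coe_finset_left [G.LocallyFinite] (s : Finset V) (t : Set V) :
    (edgesBetween G s t).encard = ∑ v ∈ s, degreeIn G t v := by
  classical
  induction s using Finset.induction_on with
  | empty => simp [edgesBetween]
  | insert v s hv ih =>
    rw [Finset.coe_insert, Set.insert_eq,
      encard_edgesBetween_union_left (Set.disjoint_singleton_left.2 hv),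
      encard_edgesBetween_singleton_left, ih, Finset.sum_insert hv, Nat.cast_add]

end EdgesBetween

section Cut

variable {A : Set V} {x y : V} {k : ℕ}

/-- The edge cut of `A`: the edges leaving `A`, oriented from `A` to its complement. -/
def cut (G : SimpleGraph V) (A : Set V) : Set (V × V) :=
  edgesBetween G A Aᶜ

/-- The inner vertex boundary of `A`: the vertices of `A` with a neighbour outside `A`. -/
def boundary (G : SimpleGraph V) (A : Set V) : Set V :=
  {v | v ∈ A ∧ ∃ w ∉ A, G.Adj v w}

/-- The interior of `A`: the vertices of `A` all of whose neighbours lie in `A`. -/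
def interior (G : SimpleGraph V) (A : Set V) : Set V :=
  A \ boundary G A

theorem fst_image_cut : Prod.fst '' cut G A = boundary G A := by
  ext v
  simp [cut, edgesBetween, boundary]

theorem encard_cut_compl (G : SimpleGraph V) (A : Set V) :
    (cut G Aᶜ).encard = (cut G A).encard := by
  rw [cut, cut, compl_compl, encard_edgesBetween_comm]

theorem finite_boundary (hk : (cut G A).encard = k) : (boundary G A).Finite :=
  fst_image_cut ▸ (Set.finite_of_encard_eq_coe hk).image _

theorem boundary_subset (G : SimpleGraph V) (A : Set V) : boundary G A ⊆ A :=
  fun _ h => h.1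

theorem mem_boundary_compl (hx : x ∈ A) (hy : y ∉ A) (h : G.Adj x y) : y ∈ boundary G Aᶜ :=
  ⟨hy, x, not_not.2 hx, h.symm⟩

theorem nonempty_boundary (hconn : G.Preconnected) (hA : A.Nonempty) (hA' : Aᶜ.Nonempty) :
    (boundary G A).Nonempty := by
  obtain ⟨u, hu⟩ := hA
  obtain ⟨v, hv⟩ := hA'
  obtain ⟨w⟩ := hconn u v
  obtain ⟨d, -, hd, hd'⟩ := w.exists_boundary_dart A hu hv
  exact ⟨d.fst, hd, d.snd, hd', d.adj⟩

variable [G.LocallyFinite]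

theorem encard_cut_singleton (x : V) : (cut G {x}).encard = G.degree x := by
  rw [cut, encard_edgesBetween_singleton_left, ← degreeIn_univ, Set.compl_eq_univ_sdiff,
    degreeIn_sdiff_singleton_self]

theorem encard_cut_sdiff_singleton_add (hx : x ∈ A) :
    (cut G (A \ {x})).encard + degreeIn G Aᶜ x = (cut G A).encard + degreeIn G A x := by
  have hA : A = A \ {x} ∪ {x} := (Set.sdiff_union_of_subset (Set.singleton_subset_iff.2 hx)).symm
  have hcompl : (A \ {x})ᶜ = Aᶜ ∪ {x} := by rw [Set.sdiff_eq, Set.compl_inter, compl_compl]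
  have hcut : (cut G A).encard = (edgesBetween G (A \ {x}) Aᶜ).encard + degreeIn G Aᶜ x := by
    rw [← encard_edgesBetween_singleton_left, ← encard_edgesBetween_union_left
      Set.disjoint_sdiff_left, ← hA, cut]
  rw [cut, hcompl, encard_edgesBetween_union_right (Set.disjoint_singleton_right.2 (not_not.2 hx)),
    encard_edgesBetween_comm _ {x}, encard_edgesBetween_singleton_left,
    degreeIn_sdiff_singleton_self, hcut, add_right_comm]

theorem degreeIn_eq_boundary_add_interior (A : Set V) (x : V) :
    degreeIn G A x = degreeIn G (boundary G A) x + degreeIn G (interior G A) x := by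
  rw [interior, ← degreeIn_union Set.disjoint_sdiff_right,
    Set.union_sdiff_cancel (boundary_subset G A)]

theorem degree_eq_compl_add_boundary_add_interior (A : Set V) (x : V) :
    G.degree x =
      degreeIn G Aᶜ x + degreeIn G (boundary G A) x + degreeIn G (interior G A) x := by
  rw [add_assoc, ← degreeIn_eq_boundary_add_interior, ← degreeIn_union disjoint_compl_left,
    Set.compl_union_self, degreeIn_univ]

theorem sum_degreeIn_compl_add_ncard_boundary_le (hk : (cut G A).encard = k) {s : Finset V}
    (hs : ↑s ⊆ A) : ∑ v ∈ s, degreeIn G Aᶜ v + (boundary G A).ncard ≤ k + s.card := by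
  have hcut : (cut G A).encard =
      ∑ v ∈ s, degreeIn G Aᶜ v + (edgesBetween G (A \ s) Aᶜ).encard := by
    rw [← encard_edgesBetween_coe_finset_left, ← encard_edgesBetween_union_left
      Set.disjoint_sdiff_right, Set.union_sdiff_cancel hs, cut]
  have hsub : boundary G A \ s ⊆ Prod.fst '' edgesBetween G (A \ s) Aᶜ := by
    rintro v ⟨⟨hv, w, hw, hvw⟩, hvs⟩
    exact ⟨(v, w), ⟨⟨hv, hvs⟩, hw, hvw⟩, rfl⟩
  have hboundary : (boundary G A).encard ≤ (edgesBetween G (A \ s) Aᶜ).encard + s.card :=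
    calc (boundary G A).encard
        ≤ (boundary G A \ s).encard + (s : Set V).encard :=
        Set.encard_le_encard_sdiff_add_encard _ _
      _ ≤ (edgesBetween G (A \ s) Aᶜ).encard + s.card := by
        rw [Set.encard_coe_eq_coe_finsetCard]
        gcongr
        exact (Set.encard_le_encard hsub).trans (Set.encard_image_le _ _)
  rw [← Nat.cast_le (α := ℕ∞)]
  push_cast
  rw [← hk, hcut, (finite_boundary hk).cast_ncard_eq, add_assoc]
  push_cast
  gcongr

theorem degreeIn_compl_add_ncard_boundary_le (hk : (cut G A).encard = k) (hx : x ∈ A) :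
    degreeIn G Aᶜ x + (boundary G A).ncard ≤ k + 1 := by
  simpa using sum_degreeIn_compl_add_ncard_boundary_le hk (s := {x}) (by simpa using hx)

end Cut

section CutPotential

variable {A : Set V} {x y : V} {k : ℕ}

/-- The signed distance to the edge cut of `A`, truncated so that it is `-1` on the interior of
`A`, `0` on its boundary, `1` on the boundary of `Aᶜ` and `2` on the interior of `Aᶜ`. -/
noncomputable def cutPotential (G : SimpleGraph V) (A : Set V) : V → ℝ :=
  Aᶜ.indicator 1 - (interior G A).indicator 1 + (interior G Aᶜ).indicator 1

theorem cutPotential_compl (G : SimpleGraph V) (A : Set V) :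
    cutPotential G Aᶜ = 1 - cutPotential G A := by
  have hcompl : A.indicator (1 : V → ℝ) = 1 - Aᶜ.indicator 1 :=
    eq_sub_of_add_eq (Set.indicator_self_add_compl A 1)
  rw [cutPotential, cutPotential, compl_compl, hcompl]
  ring

theorem cutPotential_of_mem_boundary (hx : x ∈ boundary G A) : cutPotential G A x = 0 := by
  simp [cutPotential, interior, hx, hx.1]

theorem cutPotential_of_mem_boundary_compl (hx : x ∈ boundary G Aᶜ) : cutPotential G A x = 1 := by
  have := cutPotential_of_mem_boundary hx
  rw [cutPotential_compl, Pi.sub_apply, Pi.one_apply] at this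
  linarith

theorem cutPotential_mem_Icc (hx : x ∈ A) : cutPotential G A x ∈ Set.Icc (-1 : ℝ) 0 := by
  by_cases hx' : x ∈ boundary G A <;> simp [cutPotential, interior, hx, hx']

theorem cutPotential_mem_Icc_of_notMem (hx : x ∉ A) : cutPotential G A x ∈ Set.Icc (1 : ℝ) 2 := by
  obtain ⟨h₁, h₂⟩ := cutPotential_mem_Icc (G := G) (Set.mem_compl hx)
  rw [cutPotential_compl, Pi.sub_apply, Pi.one_apply] at h₁ h₂
  constructor <;> linarith

theorem cutPotential_sub_le_one (h : G.Adj x y) : cutPotential G A y - cutPotential G A x ≤ 1 := by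
  by_cases hx : x ∈ A <;> by_cases hy : y ∈ A
  · linarith [(cutPotential_mem_Icc (G := G) hx).1, (cutPotential_mem_Icc (G := G) hy).2]
  · rw [cutPotential_of_mem_boundary ⟨hx, y, hy, h⟩,
      cutPotential_of_mem_boundary_compl (mem_boundary_compl hx hy h), sub_zero]
  · linarith [(cutPotential_mem_Icc_of_notMem (G := G) hx).1,
      (cutPotential_mem_Icc (G := G) hy).2]
  · linarith [(cutPotential_mem_Icc_of_notMem (G := G) hx).1,
      (cutPotential_mem_Icc_of_notMem (G := G) hy).2]

variable [G.LocallyFinite]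

theorem laplacian_cutPotential (hx : x ∈ boundary G A) :
    laplacian G (cutPotential G A) x =
      ((degreeIn G Aᶜ x : ℝ) - degreeIn G (interior G A) x) / G.degree x := by
  have hneighbor : ∀ v ∈ G.neighborFinset x, cutPotential G A v - cutPotential G A x =
      Aᶜ.indicator 1 v - (interior G A).indicator 1 v := by
    intro v hv
    have hv' : v ∉ interior G Aᶜ := fun h =>
      h.2 (mem_boundary_compl hx.1 h.1 ((G.mem_neighborFinset x v).1 hv))
    rw [cutPotential_of_mem_boundary hx]
    simp [cutPotential, hv']
  rw [laplacian, Finset.sum_congr rfl hneighbor, Finset.sum_sub_distrib,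
    sum_indicator_one_neighborFinset, sum_indicator_one_neighborFinset]

theorem laplacian_cutPotential_compl (A : Set V) (x : V) :
    laplacian G (cutPotential G Aᶜ) x = -laplacian G (cutPotential G A) x := by
  simp only [laplacian, cutPotential_compl, Pi.sub_apply, Pi.one_apply, sub_sub_sub_cancel_left,
    ← neg_div, ← Finset.sum_neg_distrib, neg_sub]

theorem HasPositiveCurvature.laplacian_cutPotential_add_pos (hpos : HasPositiveCurvature G)
    (hconn : G.Preconnected) (hx : x ∈ A) (hy : y ∉ A) (h : G.Adj x y) :
    0 < laplacian G (cutPotential G A) x + laplacian G (cutPotential G Aᶜ) y := by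
  have hdist : G.dist x y = 1 := SimpleGraph.dist_eq_one_iff_adj.2 h
  have hbound := curvature_le (hdist ▸ one_ne_zero)
    (fun u v => sub_le_dist_of_reachable (fun _ _ => cutPotential_sub_le_one (A := A)) (hconn u v))
    (by rw [cutPotential_of_mem_boundary ⟨hx, y, hy, h⟩,
      cutPotential_of_mem_boundary_compl (mem_boundary_compl hx hy h), hdist]; norm_num)
  rw [hdist, Nat.cast_one, div_one, sub_eq_add_neg, ← laplacian_cutPotential_compl] at hbound
  exact (hpos x y h).trans_le hbound

theorem laplacian_cutPotential_le (hx : x ∈ boundary G A) (hk : k < G.degree x) :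
    laplacian G (cutPotential G A) x ≤
      (2 * degreeIn G Aᶜ x + degreeIn G (boundary G A) x : ℝ) / (k + 1) - 1 := by
  have hdeg : (G.degree x : ℝ) = degreeIn G Aᶜ x + degreeIn G (boundary G A) x +
      degreeIn G (interior G A) x := mod_cast degree_eq_compl_add_boundary_add_interior A x
  have hk' : (k + 1 : ℝ) ≤ G.degree x := mod_cast hk
  have hpos : (0 : ℝ) < k + 1 := by positivity
  calc laplacian G (cutPotential G A) x
      = (2 * degreeIn G Aᶜ x + degreeIn G (boundary G A) x : ℝ) / G.degree x - 1 := by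
        rw [laplacian_cutPotential hx, eq_sub_iff_add_eq, div_add_one (hpos.trans_le hk').ne', hdeg]
        ring
    _ ≤ _ := by gcongr

theorem HasPositiveCurvature.lt_two_mul_degreeIn_add (hpos : HasPositiveCurvature G)
    (hconn : G.Preconnected) (hx : x ∈ A) (hy : y ∉ A) (h : G.Adj x y) (hkx : k < G.degree x)
    (hky : k < G.degree y) :
    2 * (k + 1) < 2 * degreeIn G Aᶜ x + degreeIn G (boundary G A) x +
      (2 * degreeIn G A y + degreeIn G (boundary G Aᶜ) y) := by
  have hlap := hpos.laplacian_cutPotential_add_pos hconn hx hy h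
  have hlapx := laplacian_cutPotential_le (A := A) ⟨hx, y, hy, h⟩ hkx
  have hlapy := laplacian_cutPotential_le (mem_boundary_compl hx hy h) hky
  rw [compl_compl] at hlapy
  have hlt : (2 : ℝ) < (2 * degreeIn G Aᶜ x + degreeIn G (boundary G A) x +
      (2 * degreeIn G A y + degreeIn G (boundary G Aᶜ) y)) / (k + 1) := by
    rw [add_div]
    linarith
  rw [lt_div_iff₀ (by positivity)] at hlt
  exact_mod_cast hlt

end CutPotential

section Exposed

variable {A : Set V} {x y : V} {k : ℕ}

/-- A vertex `x` of `A` is exposed if it has more neighbours outside `A` than in the interior of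
`A`, that is, if the Laplacian of `cutPotential G A` is positive at `x`. -/
def IsExposed (G : SimpleGraph V) (A : Set V) (x : V) : Prop :=
  x ∈ A ∧ degreeIn G (interior G A) x < degreeIn G Aᶜ x

variable [G.LocallyFinite]

theorem IsExposed.mem_boundary (hx : IsExposed G A x) : x ∈ boundary G A :=
  ⟨hx.1, degreeIn_pos_iff.1 (Nat.zero_lt_of_lt hx.2)⟩

theorem isExposed_of_laplacian_pos (hx : x ∈ boundary G A)
    (h : 0 < laplacian G (cutPotential G A) x) : IsExposed G A x := by
  refine ⟨hx.1, ?_⟩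
  contrapose! h
  rw [laplacian_cutPotential hx]
  exact div_nonpos_of_nonpos_of_nonneg (sub_nonpos.2 (mod_cast h)) (Nat.cast_nonneg _)

theorem HasPositiveCurvature.isExposed_or_isExposed_compl (hpos : HasPositiveCurvature G)
    (hconn : G.Preconnected) (hx : x ∈ A) (hy : y ∉ A) (h : G.Adj x y) :
    IsExposed G A x ∨ IsExposed G Aᶜ y :=
  (lt_or_lt_of_add_lt_add
    ((add_zero 0).trans_lt (hpos.laplacian_cutPotential_add_pos hconn hx hy h))).imp
    (isExposed_of_laplacian_pos ⟨hx, y, hy, h⟩)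
    (isExposed_of_laplacian_pos (mem_boundary_compl hx hy h))

theorem IsExposed.add_three_le (hx : IsExposed G A x) (hk : (cut G A).encard = k)
    (hdeg : k < G.degree x) : k + 3 ≤ 2 * degreeIn G Aᶜ x + (boundary G A).ncard := by
  have hboundary := degreeIn_lt_ncard (G := G) (finite_boundary hk) hx.mem_boundary
  have hdegree := degree_eq_compl_add_boundary_add_interior (G := G) A x
  have hexposed := hx.2
  omega

theorem IsExposed.eq (hx : IsExposed G A x) (hy : IsExposed G A y) (hk : (cut G A).encard = k)
    (hdegx : k < G.degree x) (hdegy : k < G.degree y) : x = y := by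
  classical
  by_contra hne
  have hsum := sum_degreeIn_compl_add_ncard_boundary_le hk (s := {x, y})
    (by simp [Set.insert_subset_iff, hx.1, hy.1])
  rw [Finset.sum_pair hne, Finset.card_pair hne] at hsum
  have hx' := hx.add_three_le hk hdegx
  have hy' := hy.add_three_le hk hdegy
  omega

theorem exists_mem_interior_adj (hx : x ∈ boundary G A) (hk : (cut G A).encard = k)
    (hdeg : k < G.degree x) : ∃ z ∈ interior G A, G.Adj x z := by
  have hcompl := degreeIn_compl_add_ncard_boundary_le hk hx.1
  have hboundary := degreeIn_lt_ncard (G := G) (finite_boundary hk) hx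
  have hdegree := degree_eq_compl_add_boundary_add_interior (G := G) A x
  exact degreeIn_pos_iff.1 (by omega)

end Exposed

section MinCut

variable {A : Set V} {x y : V} {k : ℕ}

/-- `A` is a side of a minimum edge cut: it is a nonempty proper subset, and no edge cut of such a
subset has fewer edges. -/
structure IsMinCut (G : SimpleGraph V) (A : Set V) : Prop where
  nonempty : A.Nonempty
  nonempty_compl : Aᶜ.Nonempty
  encard_cut_le {B : Set V} : B.Nonempty → Bᶜ.Nonempty → (cut G A).encard ≤ (cut G B).encard

theorem IsMinCut.compl (hA : IsMinCut G A) : IsMinCut G Aᶜ where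
  nonempty := hA.nonempty_compl
  nonempty_compl := (compl_compl A).symm ▸ hA.nonempty
  encard_cut_le hB hB' := (encard_cut_compl G A).trans_le (hA.encard_cut_le hB hB')

theorem exists_isMinCut [Nontrivial V] (G : SimpleGraph V) : ∃ A, IsMinCut G A := by
  obtain ⟨v⟩ := (inferInstance : Nonempty V)
  obtain ⟨A, ⟨hA, hA'⟩, hmin⟩ := exists_minimalFor_of_wellFoundedLT
    (fun A : Set V => A.Nonempty ∧ Aᶜ.Nonempty) (fun A => (cut G A).encard)
    ⟨{v}, Set.singleton_nonempty v, Set.nonempty_compl_of_nontrivial v⟩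
  exact ⟨A, hA, hA', fun {B} hB hB' => (le_total _ _).elim id fun h => hmin ⟨hB, hB'⟩ h⟩

variable [G.LocallyFinite]

theorem IsMinCut.degreeIn_compl_le (hA : IsMinCut G A) (hk : (cut G A).encard = k) (hx : x ∈ A)
    (hne : (A \ {x}).Nonempty) : degreeIn G Aᶜ x ≤ degreeIn G A x := by
  have hmove := encard_cut_sdiff_singleton_add (G := G) hx
  have hmin := hA.encard_cut_le hne ⟨x, fun h => h.2 rfl⟩
  rw [hk] at hmove hmin
  have hle : (k : ℕ∞) + degreeIn G Aᶜ x ≤ k + degreeIn G A x := hmove ▸ by gcongr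
  exact_mod_cast (ENat.add_le_add_iff_left (ENat.natCast_ne_top k)).1 hle

theorem IsMinCut.exists_mem_boundary_ne (hA : IsMinCut G A) (hk : (cut G A).encard = k)
    (hx : IsExposed G A x) (hdeg : k < G.degree x) : ∃ u ∈ boundary G A, u ≠ x := by
  obtain ⟨z, hz, hxz⟩ := exists_mem_interior_adj hx.mem_boundary hk hdeg
  have hle := hA.degreeIn_compl_le hk hx.1 ⟨z, hz.1, hxz.ne'⟩
  rw [degreeIn_eq_boundary_add_interior A] at hle
  have hexposed := hx.2
  obtain ⟨u, hu, hxu⟩ := degreeIn_pos_iff.1 (show 0 < degreeIn G (boundary G A) x by omega)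
  exact ⟨u, hu, hxu.ne'⟩

theorem IsMinCut.exists_isExposed_compl (hA : IsMinCut G A) (hpos : HasPositiveCurvature G)
    (hconn : G.Preconnected) (hk : (cut G A).encard = k) (hdeg : ∀ v, k < G.degree v)
    (hx : IsExposed G A x) : ∃ y, IsExposed G Aᶜ y := by
  obtain ⟨u, ⟨hu, v, hv, huv⟩, hux⟩ := hA.exists_mem_boundary_ne hk hx (hdeg x)
  have hu' : ¬ IsExposed G A u := fun h => hux (h.eq hx hk (hdeg u) (hdeg x))
  exact ⟨v, (hpos.isExposed_or_isExposed_compl hconn hu hv huv).resolve_left hu'⟩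

theorem IsMinCut.exists_isExposed (hA : IsMinCut G A) (hpos : HasPositiveCurvature G)
    (hconn : G.Preconnected) (hk : (cut G A).encard = k) (hdeg : ∀ v, k < G.degree v) :
    (∃ x, IsExposed G A x) ∧ ∃ y, IsExposed G Aᶜ y := by
  obtain ⟨u, hu, v, hv, huv⟩ := nonempty_boundary hconn hA.nonempty hA.nonempty_compl
  obtain hx | hy := hpos.isExposed_or_isExposed_compl hconn hu hv huv
  · exact ⟨⟨u, hx⟩, hA.exists_isExposed_compl hpos hconn hk hdeg hx⟩
  · have hx := hA.compl.exists_isExposed_compl hpos hconn ((encard_cut_compl G A).trans hk) hdeg hy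
    rw [compl_compl] at hx
    exact ⟨hx, v, hy⟩

/-- Apply positive curvature to an edge from `x` to some `z ∉ A` other than `y`: all neighbours of
`z` in `A` are equal to `x`. -/
theorem IsExposed.two_mul_add_three_le (hx : IsExposed G A x) (hpos : HasPositiveCurvature G)
    (hconn : G.Preconnected) (hk : (cut G A).encard = k) (hdeg : ∀ v, k < G.degree v)
    (hcut : ∀ u ∈ A, ∀ v ∉ A, G.Adj u v → u = x ∨ v = y) :
    2 * k + 3 ≤
      2 * degreeIn G Aᶜ x + (boundary G A).ncard + (boundary G Aᶜ).ncard := by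
  have hcompl : 1 < degreeIn G Aᶜ x :=
    (Nat.succ_le_of_lt (degreeIn_pos_iff.2 (exists_mem_interior_adj hx.mem_boundary hk
      (hdeg x)))).trans_lt hx.2
  obtain ⟨z, ⟨hxz, hzA⟩, hzy⟩ := Set.exists_ne_of_one_lt_ncard hcompl y
  have hz : degreeIn G A z ≤ 1 := (Set.ncard_le_ncard (t := {x}) fun w hw =>
    (hcut w hw.2 z hzA hw.1.symm).resolve_right hzy).trans_eq (Set.ncard_singleton x)
  have hcurv := hpos.lt_two_mul_degreeIn_add hconn hx.1 hzA hxz (hdeg x) (hdeg z)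
  have hboundary := degreeIn_lt_ncard (G := G) (finite_boundary hk) hx.mem_boundary
  have hboundary' := degreeIn_lt_ncard (G := G)
    (finite_boundary ((encard_cut_compl G A).trans hk)) (mem_boundary_compl hx.1 hzA hxz)
  omega

theorem IsMinCut.exists_degree_le (hA : IsMinCut G A) (hpos : HasPositiveCurvature G)
    (hconn : G.Preconnected) (hk : (cut G A).encard = k) : ∃ v, G.degree v ≤ k := by
  by_contra! hdeg
  have hk' := (encard_cut_compl G A).trans hk
  obtain ⟨⟨x, hx⟩, y, hy⟩ := hA.exists_isExposed hpos hconn hk hdeg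
  have hcut : ∀ u ∈ A, ∀ v ∉ A, G.Adj u v → u = x ∨ v = y := fun u hu v hv huv =>
    (hpos.isExposed_or_isExposed_compl hconn hu hv huv).imp
      (fun h => h.eq hx hk (hdeg u) (hdeg x)) (fun h => h.eq hy hk' (hdeg v) (hdeg y))
  have hcurvx := hx.two_mul_add_three_le hpos hconn hk hdeg hcut
  have hcurvy := hy.two_mul_add_three_le hpos hconn hk' hdeg
    fun v hv u hu huv => (hcut u (not_not.1 hu) v hv huv.symm).symm
  rw [compl_compl] at hcurvy
  have hx' := degreeIn_compl_add_ncard_boundary_le hk hx.1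
  have hy' := degreeIn_compl_add_ncard_boundary_le hk' hy.1
  rw [compl_compl] at hy'
  omega

theorem IsMinCut.minDegree_le_encard_cut (hA : IsMinCut G A) (hpos : HasPositiveCurvature G)
    (hconn : G.Preconnected) : (minDegree G : ℕ∞) ≤ (cut G A).encard := by
  cases hk : (cut G A).encard with
  | top => exact le_top
  | coe k =>
    obtain ⟨v, hv⟩ := hA.exists_degree_le hpos hconn hk
    exact_mod_cast (ciInf_le (OrderBot.bddBelow _) v).trans hv

theorem exists_degree_eq_minDegree [Nonempty V] (G : SimpleGraph V) [G.LocallyFinite] :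
    ∃ v, G.degree v = minDegree G :=
  ciInf_mem fun v => G.degree v

theorem IsMinCut.encard_cut_le_minDegree [Nontrivial V] (hA : IsMinCut G A) :
    (cut G A).encard ≤ minDegree G := by
  obtain ⟨v, hv⟩ := exists_degree_eq_minDegree G
  rw [← hv, ← encard_cut_singleton]
  exact hA.encard_cut_le (Set.singleton_nonempty v) (Set.nonempty_compl_of_nontrivial v)

theorem minDegree_of_subsingleton [Nonempty V] [Subsingleton V] : minDegree G = 0 := by
  obtain ⟨v, hv⟩ := exists_degree_eq_minDegree G
  rw [← hv, SimpleGraph.degree_eq_zero_of_subsingleton]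

end MinCut

section EdgeConnectivity

variable {A : Set V}

theorem encard_image_sym2Mk_cut (G : SimpleGraph V) (A : Set V) :
    ((fun e : V × V => s(e.1, e.2)) '' cut G A).encard = (cut G A).encard := by
  refine Set.InjOn.encard_image ?_
  rintro ⟨a, b⟩ ⟨ha, -⟩ ⟨c, d⟩ ⟨-, hd, -⟩ h
  obtain ⟨rfl, rfl⟩ | ⟨rfl, rfl⟩ := Sym2.eq_iff.1 h
  · rfl
  · exact absurd ha hd

theorem not_connected_deleteEdges_cut (hA : A.Nonempty) (hA' : Aᶜ.Nonempty) :
    ¬ (G.deleteEdges ((fun e : V × V => s(e.1, e.2)) '' cut G A)).Connected := by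
  intro h
  obtain ⟨u, hu, v, hv, huv⟩ := nonempty_boundary h.preconnected hA hA'
  rw [SimpleGraph.deleteEdges_adj] at huv
  exact huv.2 ⟨(u, v), ⟨hu, hv, huv.1⟩, rfl⟩

theorem exists_encard_cut_le_of_not_connected_deleteEdges [Nonempty V] {S : Set (Sym2 V)}
    (hS : ¬ (G.deleteEdges S).Connected) :
    ∃ A : Set V, A.Nonempty ∧ Aᶜ.Nonempty ∧ (cut G A).encard ≤ S.encard := by
  have hS' : ¬ (G.deleteEdges S).Preconnected := fun h => hS ⟨h⟩
  simp only [SimpleGraph.Preconnected, not_forall] at hS'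
  obtain ⟨u, w, huw⟩ := hS'
  refine ⟨{v | (G.deleteEdges S).Reachable u v}, ⟨u, .refl u⟩, ⟨w, huw⟩, ?_⟩
  rw [← encard_image_sym2Mk_cut]
  refine Set.encard_le_encard ?_
  rintro _ ⟨e, ⟨hu, hv, huv⟩, rfl⟩
  by_contra he
  exact hv (hu.trans (SimpleGraph.deleteEdges_adj.2 ⟨huv, he⟩).reachable)

theorem IsMinCut.edgeConnectivity_eq [Nontrivial V] (hA : IsMinCut G A) :
    edgeConnectivity G = (cut G A).encard := by
  rw [edgeConnectivity, if_pos ‹Nontrivial V›]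
  refine le_antisymm (sInf_le ⟨_, ?_, encard_image_sym2Mk_cut G A,
    not_connected_deleteEdges_cut hA.nonempty hA.nonempty_compl⟩) (le_sInf ?_)
  · rintro _ ⟨e, he, rfl⟩
    exact he.2.2
  · rintro _ ⟨S, -, rfl, hS⟩
    obtain ⟨B, hB, hB', hle⟩ := exists_encard_cut_le_of_not_connected_deleteEdges hS
    exact (hA.encard_cut_le hB hB').trans hle

theorem edgeConnectivity_of_subsingleton [Subsingleton V] (G : SimpleGraph V) :
    edgeConnectivity G = 0 :=
  if_neg (not_nontrivial V)

end EdgeConnectivity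

end LLY

theorem mainTheorem1 {V : Type*} (G : SimpleGraph V) [G.LocallyFinite]
    (hconn : G.Connected) (hpos : LLY.HasPositiveCurvature G) :
    LLY.edgeConnectivity G = (LLY.minDegree G : ℕ∞) := by
  have := hconn.nonempty
  obtain hV | hV := subsingleton_or_nontrivial V
  · rw [LLY.edgeConnectivity_of_subsingleton, LLY.minDegree_of_subsingleton, Nat.cast_zero]
  · obtain ⟨A, hA⟩ := LLY.exists_isMinCut G
    rw [hA.edgeConnectivity_eq]
    exact le_antisymm hA.encard_cut_le_minDegree
      (hA.minDegree_le_encard_cut hpos hconn.preconnected)
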